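/- Let $(M,\omega)$ be a symplectic manifold of dimension $2n$ (Hausdorff, second countable), and for $V\subset M$ open let $C^\infty(V)$ be the algebra of complex valued smooth functions on $V$. Let $\{f,g\}=\omega(X_f,X_g)$, with $\omega(X_f,-)=df$, be the ($\mathbb C$-bilinearly extended) Poisson bracket. Let $\star$ be a formal deformation quantization of $(M,\omega)$, i.e. an associative $\mathbb C[[\hbar]]$-bilinear product on $C^\infty(M)[[\hbar]]$ with unit $1$, given by $$f\star g=fg+\sum_{k\ge 1}\hbar^kB_k(f,g)$$ with bidifferential operators $B_k$, and such that $f\star g-g\star f=i\hbar\{f,g\}+O(\hbar^2)$. Bidifferential operators restrict to open sets, so $\star$ defines a sheaf of algebras $\mathbb A_\hbar$ on $M$, $\mathbb A_\hbar(V)=(C^\infty(V)[[\hbar]],\star)$. Let $\mathcal Z$ be the sheaf $V\mapsto C^\infty(V)[[\hbar]]$ with the usual commutative product, and denote invertible elements by a superscript $\times$. Let $\mathcal U=\{U_i\}_{i\in J}$ be a good cover of $M$, i.e. an open cover all of whose nonempty finite intersections are contractible. For a sheaf of groups $G$, $\check{\mathrm H}^1(\mathcal U,G)$ denotes the pointed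 set of $1$-cocycles $c_{ij}\in G(U_i\cap U_j)$, $c_{ij}c_{jk}=c_{ik}$ on $U_i\cap U_j\cap U_k$, modulo $c_{ij}\sim a_ic_{ij}a_j^{-1}$ with $a_i\in G(U_i)$; it is an abelian group if $G$ is abelian. Abelian groups without further structure are regarded as constant sheaves. Then: 1. Reduction modulo $\hbar$, $f_0+\hbar f_1+\cdots\mapsto f_0$, induces an isomorphism of groups $$P_1\colon\check{\mathrm H}^1(\mathcal U,\mathcal Z^\times)\xrightarrow{\ \sim\ }\check{\mathrm H}^1(\mathcal U,(C^\infty)^\times).$$ 2. Reduction modulo $\hbar$ induces a map of pointed sets $$P_2\colon\check{\mathrm H}^1(\mathcal U,\mathbb A_\hbar^\times)\longrightarrow\check{\mathrm H}^1(\mathcal U,(C^\infty)^\times)$$ with trivial kernel: $P_2(c)=1$ if and only if $c=1$. 3. The exponential $\exp f=\sum_{k\ge0}f^k/k!$ induces an isomorphism of groups $\exp_*\colon\check{\mathrm H}^1(\mathcal U,\hbar\mathbb C[[\hbar]])\to\check{\mathrm H}^1(\mathcal U,1+\hbar\mathbb C[[\hbar]])$, and there is an isomorphism of groups $$P_3\colon\check{\mathrm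 H}^1(\mathcal U,1+\hbar\mathbb C[[\hbar]])\xrightarrow{\ \sim\ }\hbar\,\check{\mathrm H}^1(\mathcal U,\mathbb C)[[\hbar]]$$ such that $P_3(\exp_*x)=\sum_{k\ge1}\hbar^k x_k$ for all $x\in\check{\mathrm H}^1(\mathcal U,\hbar\mathbb C[[\hbar]])$, where $x_k\in\check{\mathrm H}^1(\mathcal U,\mathbb C)$ is the image of $x$ under the map induced by taking the coefficient of $\hbar^k$. Here $\hbar H[[\hbar]]$ is the group of formal power series with coefficients in the abelian group $H$ and zero constant term. -/

import Mathlib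

open CategoryTheory TopologicalSpace
open scoped Manifold ContDiff Topology

noncomputable section

namespace DefQuant

universe u v w

/-! ### Complex valued smooth functions -/

/-- The model space `ℝ²ⁿ`. -/
abbrev E (n : ℕ) := EuclideanSpace ℝ (Fin (2 * n))

/-- The `ℂ`-algebra `C^∞(N)` of complex valued smooth functions on a `2n`-dimensional manifold. -/
def smoothFun (n : ℕ) (N : Type u) [TopologicalSpace N] [ChartedSpace (E n) N] :
    Subalgebra ℂ (N → ℂ) where
  carrier := {f | ContMDiff (𝓡 (2 * n)) 𝓘(ℝ, ℂ) ∞ f}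
  mul_mem' {f g} hf hg := by
    have h : ContDiff ℝ ∞ fun p : ℂ × ℂ => p.1 * p.2 := contDiff_mul
    exact h.contMDiff.comp (ContMDiff.prodMk_space hf hg)
  add_mem' hf hg := ContMDiff.add hf hg
  algebraMap_mem' c := contMDiff_const

variable {n : ℕ} {M : Type u} [TopologicalSpace M] [ChartedSpace (E n) M]

/-- Restriction of smooth functions to a smaller open set. -/
def smoothRes {U V : Opens M} (h : V ≤ U) : smoothFun n U →ₐ[ℂ] smoothFun n V where
  toFun f := ⟨fun x => f.1 (Opens.inclusion h x),
    ContMDiff.comp (g := f.1) f.2 (contMDiff_inclusion h)⟩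
  map_one' := rfl
  map_mul' _ _ := rfl
  map_zero' := rfl
  map_add' _ _ := rfl
  commutes' _ := rfl

/-! ### Symplectic forms and the Poisson bracket -/

/-- The expression of a field of alternating 2-forms in the chart around `x₀`. -/
def chartForm (Ω : ∀ x : M, (TangentSpace (𝓡 (2 * n)) x) [⋀^Fin 2]→L[ℝ] ℝ) (x₀ : M) (y : E n) :
    (E n) [⋀^Fin 2]→L[ℝ] ℝ :=
  (Ω ((chartAt (E n) x₀).symm y)).compContinuousLinearMap
    (mfderiv 𝓘(ℝ, E n) (𝓡 (2 * n)) (chartAt (E n) x₀).symm y)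

variable (n M) in
/-- A symplectic form on `M`: a smooth, closed, nondegenerate 2-form. -/
structure SymplecticForm where
  /-- the value of the form at a point -/
  toFun : ∀ x : M, (TangentSpace (𝓡 (2 * n)) x) [⋀^Fin 2]→L[ℝ] ℝ
  smooth : ∀ x₀ : M, ContDiffOn ℝ ∞ (chartForm toFun x₀) (chartAt (E n) x₀).target
  closed : ∀ x₀ : M, ∀ y ∈ (chartAt (E n) x₀).target, extDeriv (chartForm toFun x₀) y = 0
  nondegenerate : ∀ (x : M) (v : TangentSpace (𝓡 (2 * n)) x),
    (∀ w : TangentSpace (𝓡 (2 * n)) x, toFun x ![v, w] = 0) → v = 0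

namespace SymplecticForm

variable (Ω : SymplecticForm n M)

theorem update_fst {V : Type*} (v w v' : V) : Function.update ![v, w] 0 v' = ![v', w] := by
  funext i
  fin_cases i <;> rfl

theorem update_snd {V : Type*} (v w w' : V) : Function.update ![v, w] 1 w' = ![v, w'] := by
  funext i
  fin_cases i <;> rfl

/-- The map `v ↦ Ω_x(v, -)` from tangent vectors to covectors. -/
def flat (x : M) : TangentSpace (𝓡 (2 * n)) x →ₗ[ℝ] (TangentSpace (𝓡 (2 * n)) x →ₗ[ℝ] ℝ) :=
  LinearMap.mk₂ ℝ (fun v w => Ω.toFun x ![v, w])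
    (fun v v' w => by
      simpa only [update_fst] using (Ω.toFun x).map_update_add ![v, w] 0 v v')
    (fun c v w => by
      simpa only [update_fst] using (Ω.toFun x).map_update_smul ![v, w] 0 c v)
    (fun v w w' => by
      simpa only [update_snd] using (Ω.toFun x).map_update_add ![v, w] 1 w w')
    (fun c v w => by
      simpa only [update_snd] using (Ω.toFun x).map_update_smul ![v, w] 1 c w)

/-- The isomorphism `T_x M ≃ T_x^* M`, `v ↦ Ω_x(v, -)`. -/
def flatEquiv (x : M) :
    TangentSpace (𝓡 (2 * n)) x ≃ₗ[ℝ] (TangentSpace (𝓡 (2 * n)) x →ₗ[ℝ] ℝ) :=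
  haveI : FiniteDimensional ℝ (TangentSpace (𝓡 (2 * n)) x) :=
    inferInstanceAs (FiniteDimensional ℝ (E n))
  LinearEquiv.ofInjectiveOfFinrankEq (Ω.flat x)
    ((injective_iff_map_eq_zero _).2 fun v hv => Ω.nondegenerate x v fun w =>
      LinearMap.congr_fun hv w)
    (Subspace.dual_finrank_eq (K := ℝ) (V := TangentSpace (𝓡 (2 * n)) x)).symm

/-- The value at `x` of the Hamiltonian vector field `X_u` of a real function `u`,
characterized by `Ω_x(X_u, -) = d_x u`. -/
def hamiltonianVector (u : M → ℝ) (x : M) : TangentSpace (𝓡 (2 * n)) x :=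
  (Ω.flatEquiv x).symm (mfderiv (𝓡 (2 * n)) 𝓘(ℝ, ℝ) u x).toLinearMap

/-- The Poisson bracket `{f, g} = Ω(X_f, X_g) = df(X_g)`, extended complex bilinearly to
complex valued functions. -/
def poisson (f g : M → ℂ) (x : M) : ℂ :=
  let df : TangentSpace (𝓡 (2 * n)) x → ℂ := fun v => mfderiv (𝓡 (2 * n)) 𝓘(ℝ, ℂ) f x v
  df (Ω.hamiltonianVector (fun y => (g y).re) x) +
    Complex.I * df (Ω.hamiltonianVector (fun y => (g y).im) x)

end SymplecticForm

/-! ### Bidifferential operators -/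

/-- Indices of the iterated partial derivatives of order at most `N`. -/
abbrev DerivIndex (n N : ℕ) := Σ k : Fin (N + 1), (Fin k → Fin (2 * n))

/-- The iterated partial derivative of `f`, with respect to the coordinates of the chart around
`x₀`, evaluated at `x`. -/
def chartDeriv (x₀ : M) {N : ℕ} (α : DerivIndex n N) (f : M → ℂ) (x : M) : ℂ :=
  iteratedFDeriv ℝ α.1 (f ∘ (chartAt (E n) x₀).symm) (chartAt (E n) x₀ x)
    (fun s => EuclideanSpace.single (α.2 s) (1 : ℝ))

/-- A bilinear operator on `C^∞(M)` is bidifferential if near every point it is, in coordinates,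
a finite sum `∑ a_{αβ} ∂^α f ∂^β g` with smooth coefficients. -/
def IsBidifferential (B : smoothFun n M →ₗ[ℂ] smoothFun n M →ₗ[ℂ] smoothFun n M) : Prop :=
  ∀ x₀ : M, ∃ V : Opens M, x₀ ∈ V ∧ (V : Set M) ⊆ (chartAt (E n) x₀).source ∧
    ∃ (N : ℕ) (a : DerivIndex n N → DerivIndex n N → M → ℂ),
      (∀ α β, ContMDiffOn (𝓡 (2 * n)) 𝓘(ℝ, ℂ) ∞ (a α β) V) ∧
      ∀ (f g : smoothFun n M), ∀ x ∈ V, (B f g).1 x =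
        ∑ α : DerivIndex n N, ∑ β : DerivIndex n N,
          a α β x * chartDeriv x₀ α f.1 x * chartDeriv x₀ β g.1 x

/-! ### Star products -/

/-- The product `f ⋆ g = ∑ ħ^k B_k(f, g)` on formal power series in `ħ`, where the operators `B_k`
are extended `ℂ⟦ħ⟧`-bilinearly. -/
def starMul {R : Type*} [CommRing R] [Algebra ℂ R] (B : ℕ → R →ₗ[ℂ] R →ₗ[ℂ] R)
    (f g : PowerSeries R) : PowerSeries R :=
  PowerSeries.mk fun m => ∑ p ∈ Finset.HasAntidiagonal.antidiagonal m, ∑ q ∈ Finset.HasAntidiagonal.antidiagonal p.2,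
    B p.1 (PowerSeries.coeff q.1 f) (PowerSeries.coeff q.2 g)

theorem coeff_starMul {R : Type*} [CommRing R] [Algebra ℂ R] (B : ℕ → R →ₗ[ℂ] R →ₗ[ℂ] R)
    (f g : PowerSeries R) (m : ℕ) : PowerSeries.coeff m (starMul B f g) =
      ∑ p ∈ Finset.HasAntidiagonal.antidiagonal m,
        ∑ q ∈ Finset.HasAntidiagonal.antidiagonal p.2,
          B p.1 (PowerSeries.coeff q.1 f) (PowerSeries.coeff q.2 g) :=
  PowerSeries.coeff_mk _ _

/-- A formal deformation quantization of the symplectic manifold `(M, Ω)`. Since `B_0` is the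
product, the quantization condition `f ⋆ g - g ⋆ f = iħ{f, g} + O(ħ²)` is a condition on `B_1`. -/
structure DeformationQuantization (Ω : SymplecticForm n M) where
  /-- the operators of the star product -/
  B : ℕ → smoothFun n M →ₗ[ℂ] smoothFun n M →ₗ[ℂ] smoothFun n M
  B_zero : ∀ f g, B 0 f g = f * g
  bidifferential : ∀ k, IsBidifferential (B k)
  assoc : ∀ f g h : PowerSeries (smoothFun n M),
    starMul B (starMul B f g) h = starMul B f (starMul B g h)
  quantization : ∀ (f g : smoothFun n M) (x : M),
    (B 1 f g - B 1 g f).1 x = Complex.I * Ω.poisson f.1 g.1 x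
  one_star : ∀ f : PowerSeries (smoothFun n M), starMul B 1 f = f
  star_one : ∀ f : PowerSeries (smoothFun n M), starMul B f 1 = f

/-! ### The sheaf of algebras defined by a star product -/

/-- Every smooth function on an open set `U` agrees near a given point of `U` with a global one. -/
theorem exists_extend [IsManifold (𝓡 (2 * n)) ∞ M] [T2Space M] {U : Opens M} {x : M} (hx : x ∈ U) :
    ∃ V : Opens M, x ∈ V ∧ V ≤ U ∧ ∀ f : smoothFun n U, ∃ F : smoothFun n M,
      ∀ (y : M) (_ : y ∈ V) (hU : y ∈ U), F.1 y = f.1 ⟨y, hU⟩ := by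
  classical
  obtain ⟨χ, -, hχ⟩ := (SmoothBumpFunction.nhds_basis_tsupport (I := 𝓡 (2 * n)) x).mem_iff.1
    (U.isOpen.mem_nhds hx)
  obtain ⟨W, hW, hWo, hxW⟩ := eventually_nhds_iff.1 χ.eventuallyEq_one
  refine ⟨⟨W ∩ U, hWo.inter U.isOpen⟩, ⟨hxW, hx⟩, fun y hy => hy.2, fun f => ?_⟩
  let g : M → ℂ := fun y => if h : y ∈ U then f.1 ⟨y, h⟩ else 0
  have hg : ∀ y ∈ U, ContMDiffAt (𝓡 (2 * n)) 𝓘(ℝ, ℂ) ∞ g y := by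
    intro y hy
    have h1 : ContMDiffAt (𝓡 (2 * n)) 𝓘(ℝ, ℂ) ∞ (fun z : U => g z) ⟨y, hy⟩ := by
      have : (fun z : U => g z) = f.1 := by
        funext z
        simp [g]
      rw [this]
      exact f.2 _
    exact contMDiffAt_subtype_iff.1 h1
  refine ⟨⟨fun y => χ y • g y, ?_⟩, fun y hy hU => ?_⟩
  · refine contMDiff_of_tsupport fun y hy => ?_
    exact χ.contMDiffAt.smul (hg y (hχ (tsupport_smul_subset_left _ _ hy)))
  · have : χ y = 1 := hW y hy.1
    simp [this, g, hU]

/-- Bidifferential operators are local. -/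
theorem IsBidifferential.congr {B : smoothFun n M →ₗ[ℂ] smoothFun n M →ₗ[ℂ] smoothFun n M}
    (hB : IsBidifferential B) {f f' g g' : smoothFun n M} {x : M}
    (hf : f.1 =ᶠ[𝓝 x] f'.1) (hg : g.1 =ᶠ[𝓝 x] g'.1) : (B f g).1 x = (B f' g').1 x := by
  obtain ⟨V, hxV, hV, N, a, -, h⟩ := hB x
  have key : ∀ {p q : M → ℂ}, p =ᶠ[𝓝 x] q → ∀ α : DerivIndex n N,
      chartDeriv x α p x = chartDeriv x α q x := by
    intro p q hpq α
    have ht : Filter.Tendsto (chartAt (E n) x).symm (𝓝 (chartAt (E n) x x)) (𝓝 x) :=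
      (chartAt (E n) x).tendsto_symm (mem_chart_source _ x)
    have h2 : p ∘ (chartAt (E n) x).symm =ᶠ[𝓝 (chartAt (E n) x x)]
        q ∘ (chartAt (E n) x).symm := ht.eventually hpq
    unfold chartDeriv
    rw [(Filter.EventuallyEq.iteratedFDeriv ℝ h2 _).eq_of_nhds]
  rw [h f g x hxV, h f' g' x hxV]
  simp only [key hf, key hg]

/-- Two global smooth functions that agree with the same function on an open set agree near each
of its points. -/
theorem eventuallyEq_of_forall {V : Opens M} {f g : M → ℂ} {x : M} (hx : x ∈ V)
    (h : ∀ y ∈ V, f y = g y) : f =ᶠ[𝓝 x] g :=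
  Filter.eventually_of_mem (V.isOpen.mem_nhds hx) h

section Restriction

set_option linter.unusedSectionVars false

variable [IsManifold (𝓡 (2 * n)) ∞ M] [T2Space M]

/-- A neighbourhood of `x` in `U` on which functions on `U` extend to global ones. -/
def extNhd {U : Opens M} (x : U) : Opens M := (exists_extend (n := n) x.2).choose

/-- A global smooth function that agrees near `x` with a given smooth function on `U`. -/
def extFun {U : Opens M} (x : U) (f : smoothFun n U) : smoothFun n M :=
  ((exists_extend (n := n) x.2).choose_spec.2.2 f).choose

theorem mem_extNhd {U : Opens M} (x : U) : x.1 ∈ extNhd (n := n) x :=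
  (exists_extend (n := n) x.2).choose_spec.1

theorem extNhd_le {U : Opens M} (x : U) : extNhd (n := n) x ≤ U :=
  (exists_extend (n := n) x.2).choose_spec.2.1

theorem extFun_apply {U : Opens M} (x : U) (f : smoothFun n U) (y : U)
    (hy : y.1 ∈ extNhd (n := n) x) : (extFun x f).1 y = f.1 y :=
  ((exists_extend (n := n) x.2).choose_spec.2.2 f).choose_spec y.1 hy y.2

/-- The value at `x ∈ U` of the restriction to `U` of a bidifferential operator: apply the operator
to global functions which agree with the given ones near `x`. -/
def resVal (B : smoothFun n M →ₗ[ℂ] smoothFun n M →ₗ[ℂ] smoothFun n M) (U : Opens M)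
    (f g : smoothFun n U) (x : U) : ℂ :=
  (B (extFun x f) (extFun x g)).1 x

/-- The value `resVal` does not depend on the choice of the extensions. -/
theorem resVal_eq {B : smoothFun n M →ₗ[ℂ] smoothFun n M →ₗ[ℂ] smoothFun n M}
    (hB : IsBidifferential B) {U : Opens M} {f g : smoothFun n U} {F G : smoothFun n M} {x : U}
    {V : Opens M} (hx : x.1 ∈ V)
    (hF : ∀ y : U, y.1 ∈ V → F.1 y = f.1 y) (hG : ∀ y : U, y.1 ∈ V → G.1 y = g.1 y) :
    resVal B U f g x = (B F G).1 x := by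
  have aux : ∀ {p : smoothFun n U} {P : smoothFun n M}, (∀ y : U, y.1 ∈ V → P.1 y = p.1 y) →
      (extFun x p).1 =ᶠ[𝓝 x.1] P.1 := by
    intro p P hP
    refine eventuallyEq_of_forall (V := V ⊓ extNhd (n := n) x) ⟨hx, mem_extNhd x⟩ fun y hy => ?_
    have hyU : y ∈ U := extNhd_le x hy.2
    rw [hP ⟨y, hyU⟩ hy.1]
    exact extFun_apply x p ⟨y, hyU⟩ hy.2
  exact hB.congr (aux hF) (aux hG)

/-- The restriction to an open set `U` of a bidifferential operator on `M`. -/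
def resOp (B : smoothFun n M →ₗ[ℂ] smoothFun n M →ₗ[ℂ] smoothFun n M) (hB : IsBidifferential B)
    (U : Opens M) : smoothFun n U →ₗ[ℂ] smoothFun n U →ₗ[ℂ] smoothFun n U :=
  LinearMap.mk₂ ℂ
    (fun f g => ⟨resVal B U f g, fun x => by
      have h0 : resVal B U f g =ᶠ[𝓝 x] fun z : U => (B (extFun x f) (extFun x g)).1 z := by
        have : ∀ᶠ z : U in 𝓝 x, z.1 ∈ extNhd (n := n) x :=
          continuous_subtype_val.continuousAt.eventually
            ((extNhd (n := n) x).isOpen.mem_nhds (mem_extNhd x))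
        filter_upwards [this] with z hz
        exact resVal_eq hB hz (fun y hy => extFun_apply x f y hy)
          (fun y hy => extFun_apply x g y hy)
      have h1 : ContMDiffAt (𝓡 (2 * n)) 𝓘(ℝ, ℂ) ∞
          (fun z : U => (B (extFun x f) (extFun x g)).1 z) x :=
        contMDiffAt_subtype_iff.2 ((B (extFun x f) (extFun x g)).2 x.1)
      exact h1.congr_of_eventuallyEq h0⟩)
    (fun f f' g => by
      ext x
      have := resVal_eq hB (f := f + f') (g := g) (F := extFun x f + extFun x f')
        (G := extFun x g) (mem_extNhd x)
        (fun y hy => congrArg₂ (· + ·) (extFun_apply x f y hy) (extFun_apply x f' y hy))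
        (fun y hy => extFun_apply x g y hy)
      rw [map_add, LinearMap.add_apply] at this
      exact this)
    (fun c f g => by
      ext x
      have := resVal_eq hB (f := c • f) (g := g) (F := c • extFun x f)
        (G := extFun x g) (mem_extNhd x)
        (fun y hy => congrArg (c * ·) (extFun_apply x f y hy))
        (fun y hy => extFun_apply x g y hy)
      rw [map_smul, LinearMap.smul_apply] at this
      exact this)
    (fun f g g' => by
      ext x
      have := resVal_eq hB (f := f) (g := g + g') (F := extFun x f)
        (G := extFun x g + extFun x g') (mem_extNhd x)
        (fun y hy => extFun_apply x f y hy)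
        (fun y hy => congrArg₂ (· + ·) (extFun_apply x g y hy) (extFun_apply x g' y hy))
      rw [map_add] at this
      exact this)
    (fun c f g => by
      ext x
      have := resVal_eq hB (f := f) (g := c • g) (F := extFun x f)
        (G := c • extFun x g) (mem_extNhd x)
        (fun y hy => extFun_apply x f y hy)
        (fun y hy => congrArg (c * ·) (extFun_apply x g y hy))
      rw [map_smul] at this
      exact this)

theorem resOp_apply {B : smoothFun n M →ₗ[ℂ] smoothFun n M →ₗ[ℂ] smoothFun n M}
    (hB : IsBidifferential B) {U : Opens M} {f g : smoothFun n U} {F G : smoothFun n M} {x : U}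
    {V : Opens M} (hx : x.1 ∈ V)
    (hF : ∀ y : U, y.1 ∈ V → F.1 y = f.1 y) (hG : ∀ y : U, y.1 ∈ V → G.1 y = g.1 y) :
    (resOp B hB U f g).1 x = (B F G).1 x :=
  resVal_eq hB hx hF hG

/-- The restricted operators are compatible with restriction of functions. -/
theorem resOp_smoothRes {B : smoothFun n M →ₗ[ℂ] smoothFun n M →ₗ[ℂ] smoothFun n M}
    (hB : IsBidifferential B) {U V : Opens M} (h : V ≤ U) (f g : smoothFun n U) :
    resOp B hB V (smoothRes h f) (smoothRes h g) = smoothRes h (resOp B hB U f g) := by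
  ext x
  let x' : U := Opens.inclusion h x
  rw [resOp_apply hB (U := V) (F := extFun x' f) (G := extFun x' g) (mem_extNhd x')
    (fun y hy => extFun_apply x' f (Opens.inclusion h y) hy)
    (fun y hy => extFun_apply x' g (Opens.inclusion h y) hy)]
  rfl

namespace DeformationQuantization

variable {Ω : SymplecticForm n M} (A : DeformationQuantization Ω)

/-- The operators of the star product on the open set `U`. -/
def BOn (U : Opens M) (k : ℕ) : smoothFun n U →ₗ[ℂ] smoothFun n U →ₗ[ℂ] smoothFun n U :=
  resOp (A.B k) (A.bidifferential k) U

/-- A power series of global functions extending the given one near `x`. -/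
def extSeries {U : Opens M} (x : U) (f : PowerSeries (smoothFun n U)) :
    PowerSeries (smoothFun n M) :=
  PowerSeries.mk fun m => extFun x (PowerSeries.coeff m f)

/-- `F` agrees on `V ∩ U` with `f`, coefficientwise. -/
def AgreeOn {U : Opens M} (V : Opens M) (F : PowerSeries (smoothFun n M))
    (f : PowerSeries (smoothFun n U)) : Prop :=
  ∀ (m : ℕ) (y : U), y.1 ∈ V → (PowerSeries.coeff m F).1 y = (PowerSeries.coeff m f).1 y

theorem agreeOn_extSeries {U : Opens M} (x : U) (f : PowerSeries (smoothFun n U)) :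
    AgreeOn (extNhd (n := n) x) (extSeries x f) f := by
  intro m y hy
  rw [extSeries, PowerSeries.coeff_mk]
  exact extFun_apply x _ y hy

theorem agreeOn_starMul {U V : Opens M} {F G : PowerSeries (smoothFun n M)}
    {f g : PowerSeries (smoothFun n U)} (hF : AgreeOn V F f) (hG : AgreeOn V G g) :
    AgreeOn V (starMul A.B F G) (starMul (A.BOn U) f g) := by
  intro m y hy
  rw [starMul, starMul, PowerSeries.coeff_mk, PowerSeries.coeff_mk]
  simp only [AddSubmonoidClass.coe_finsetSum, Finset.sum_apply]
  refine Finset.sum_congr rfl fun p _ => Finset.sum_congr rfl fun q _ => ?_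
  exact (resOp_apply (A.bidifferential p.1) hy (hF q.1) (hG q.2)).symm

theorem series_ext {U : Opens M} {f g : PowerSeries (smoothFun n U)}
    (h : ∀ x : U, ∃ (V : Opens M) (F : PowerSeries (smoothFun n M)), x.1 ∈ V ∧
      AgreeOn V F f ∧ AgreeOn V F g) : f = g := by
  ext m x
  obtain ⟨V, F, hx, hf, hg⟩ := h x
  rw [← hf m x hx, ← hg m x hx]

theorem agreeOn_one (U V : Opens M) :
    AgreeOn (U := U) V (1 : PowerSeries (smoothFun n M)) 1 := by
  intro m y _
  rw [PowerSeries.coeff_one, PowerSeries.coeff_one]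
  split_ifs <;> rfl

theorem starMul_assoc (U : Opens M) (f g h : PowerSeries (smoothFun n U)) :
    starMul (A.BOn U) (starMul (A.BOn U) f g) h = starMul (A.BOn U) f (starMul (A.BOn U) g h) := by
  refine series_ext fun x => ⟨extNhd (n := n) x,
    starMul A.B (starMul A.B (extSeries x f) (extSeries x g)) (extSeries x h), mem_extNhd x, ?_, ?_⟩
  · exact A.agreeOn_starMul (A.agreeOn_starMul (agreeOn_extSeries x f) (agreeOn_extSeries x g))
      (agreeOn_extSeries x h)
  · rw [A.assoc]
    exact A.agreeOn_starMul (agreeOn_extSeries x f)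
      (A.agreeOn_starMul (agreeOn_extSeries x g) (agreeOn_extSeries x h))

theorem one_starMul (U : Opens M) (f : PowerSeries (smoothFun n U)) :
    starMul (A.BOn U) 1 f = f := by
  refine series_ext fun x => ⟨extNhd (n := n) x, extSeries x f, mem_extNhd x, ?_,
    agreeOn_extSeries x f⟩
  have := A.agreeOn_starMul (agreeOn_one U (extNhd (n := n) x)) (agreeOn_extSeries x f)
  rwa [A.one_star] at this

theorem starMul_one (U : Opens M) (f : PowerSeries (smoothFun n U)) :
    starMul (A.BOn U) f 1 = f := by
  refine series_ext fun x => ⟨extNhd (n := n) x, extSeries x f, mem_extNhd x, ?_,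
    agreeOn_extSeries x f⟩
  have := A.agreeOn_starMul (agreeOn_extSeries x f) (agreeOn_one U (extNhd (n := n) x))
  rwa [A.star_one] at this

theorem BOn_zero (U : Opens M) (f g : smoothFun n U) : A.BOn U 0 f g = f * g := by
  ext x
  rw [BOn, resOp_apply (A.bidifferential 0) (mem_extNhd x) (extFun_apply x f) (extFun_apply x g),
    A.B_zero]
  exact congrArg₂ (· * ·) (extFun_apply x f x (mem_extNhd x)) (extFun_apply x g x (mem_extNhd x))

/-- The sections `𝔸_ħ(U)`: formal power series in `ħ` with coefficients in `C^∞(U)`, with the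
star product. -/
def Sections (_A : DeformationQuantization Ω) (U : Opens M) : Type u :=
  PowerSeries (smoothFun n U)

instance (U : Opens M) : AddCommGroup (A.Sections U) :=
  inferInstanceAs (AddCommGroup (PowerSeries (smoothFun n U)))

theorem starMul_add (U : Opens M) (f g h : PowerSeries (smoothFun n U)) :
    starMul (A.BOn U) f (g + h) = starMul (A.BOn U) f g + starMul (A.BOn U) f h := by
  ext1 m
  simp [starMul, Finset.sum_add_distrib]

theorem add_starMul (U : Opens M) (f g h : PowerSeries (smoothFun n U)) :
    starMul (A.BOn U) (f + g) h = starMul (A.BOn U) f h + starMul (A.BOn U) g h := by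
  ext1 m
  simp [starMul, Finset.sum_add_distrib]

theorem starMul_zero (U : Opens M) (f : PowerSeries (smoothFun n U)) :
    starMul (A.BOn U) f 0 = 0 := by
  ext1 m
  simp [starMul]

theorem zero_starMul (U : Opens M) (f : PowerSeries (smoothFun n U)) :
    starMul (A.BOn U) 0 f = 0 := by
  ext1 m
  simp [starMul]

/-- The algebra `𝔸_ħ(U)`. -/
instance (U : Opens M) : Ring (A.Sections U) :=
  { (inferInstance : AddCommGroup (A.Sections U)) with
    mul := starMul (A.BOn U)
    one := (1 : PowerSeries (smoothFun n U))
    mul_assoc := A.starMul_assoc U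
    one_mul := A.one_starMul U
    mul_one := A.starMul_one U
    left_distrib := A.starMul_add U
    right_distrib := A.add_starMul U
    zero_mul := A.zero_starMul U
    mul_zero := A.starMul_zero U }

theorem map_starMul {U V : Opens M} (h : V ≤ U) (f g : PowerSeries (smoothFun n U)) :
    PowerSeries.map (smoothRes h).toRingHom (starMul (A.BOn U) f g) =
      starMul (A.BOn V) (PowerSeries.map (smoothRes h).toRingHom f)
        (PowerSeries.map (smoothRes h).toRingHom g) := by
  ext1 m
  rw [PowerSeries.coeff_map, coeff_starMul, coeff_starMul, map_sum]
  refine Finset.sum_congr rfl fun p _ => ?_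
  rw [map_sum]
  refine Finset.sum_congr rfl fun q _ => ?_
  rw [PowerSeries.coeff_map, PowerSeries.coeff_map]
  exact (resOp_smoothRes (A.bidifferential p.1) h _ _).symm

theorem coeff_zero_starMul (U : Opens M) (f g : PowerSeries (smoothFun n U)) :
    PowerSeries.coeff 0 (starMul (A.BOn U) f g) =
      PowerSeries.coeff 0 f * PowerSeries.coeff 0 g := by
  rw [coeff_starMul]
  simpa using A.BOn_zero U _ _

/-- The restriction map `𝔸_ħ(U) → 𝔸_ħ(V)`. -/
def res {U V : Opens M} (h : V ≤ U) : A.Sections U →+* A.Sections V where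
  toFun f := PowerSeries.map (smoothRes h).toRingHom f
  map_one' := map_one (PowerSeries.map (smoothRes (n := n) h).toRingHom)
  map_zero' := map_zero (PowerSeries.map (smoothRes (n := n) h).toRingHom)
  map_add' := map_add (PowerSeries.map (smoothRes (n := n) h).toRingHom)
  map_mul' := A.map_starMul h

/-- The reduction `𝔸_ħ(U) → C^∞(U)` modulo `ħ`, `f₀ + ħ f₁ + ⋯ ↦ f₀`. -/
def reduction (U : Opens M) : A.Sections U →+* smoothFun n U where
  toFun f := PowerSeries.coeff 0 (R := smoothFun n U) f
  map_one' := by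
    change PowerSeries.coeff 0 (1 : PowerSeries (smoothFun n U)) = 1
    simp
  map_zero' := map_zero (PowerSeries.coeff 0 (R := smoothFun n U))
  map_add' := map_add (PowerSeries.coeff 0 (R := smoothFun n U))
  map_mul' := A.coeff_zero_starMul U

end DeformationQuantization

end Restriction

/-! ### First Čech cohomology -/

section Cech

open PresheafOfGroups

variable {X : Type u} [TopologicalSpace X] {J : Type v} (U : J → Opens X)

theorem cocycle_ext {G : (Opens X)ᵒᵖ ⥤ GrpCat.{w}} {γ γ' : OneCocycle G U}
    (h : γ.toOneCochain = γ'.toOneCochain) : γ = γ' := by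
  cases γ
  cases γ'
  cases h
  rfl

/-- The map on 1-cocycles induced by a morphism of presheaves of groups. -/
def mapCocycle {G G' : (Opens X)ᵒᵖ ⥤ GrpCat.{w}} (φ : G ⟶ G') (γ : OneCocycle G U) :
    OneCocycle G' U where
  ev i j T a b := φ.app (Opposite.op T) (γ.ev i j a b)
  ev_precomp i j T T' f a b := by
    have h := ConcreteCategory.congr_hom (φ.naturality f.op) (γ.ev i j a b)
    rw [← γ.ev_precomp i j f a b]
    exact h.symm
  ev_trans i j k T a b c := by
    rw [← map_mul, γ.ev_trans]

/-- The map on `Ȟ¹` induced by a morphism of presheaves of groups. -/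
def mapH1 {G G' : (Opens X)ᵒᵖ ⥤ GrpCat.{w}} (φ : G ⟶ G') : H1 G U → H1 G' U :=
  Quot.map (mapCocycle U φ) (by
    rintro γ γ' ⟨α, h⟩
    refine ⟨fun i => φ.app _ (α i), fun i j T a b => ?_⟩
    have ha := ConcreteCategory.congr_hom (φ.naturality a.op) (α i)
    have hb := ConcreteCategory.congr_hom (φ.naturality b.op) (α j)
    have key := congrArg (φ.app (Opposite.op T)) (h i j a b)
    rw [map_mul, map_mul] at key
    refine Eq.trans (congrArg (· * _) ha.symm) (Eq.trans key (congrArg (_ * ·) hb)))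

/-- The presheaf of groups underlying a presheaf of abelian groups. -/
abbrev toGrp (F : (Opens X)ᵒᵖ ⥤ CommGrpCat.{w}) : (Opens X)ᵒᵖ ⥤ GrpCat.{w} :=
  F ⋙ forget₂ CommGrpCat GrpCat

/-- `Ȟ¹(𝓤, F)` for a presheaf of abelian groups `F`. -/
abbrev CechH1 (F : (Opens X)ᵒᵖ ⥤ CommGrpCat.{w}) := H1 (toGrp F) U

variable {U} in
/-- The pointwise product of cocycles in an abelian presheaf. -/
def mulCocycle {F : (Opens X)ᵒᵖ ⥤ CommGrpCat.{w}} (γ γ' : OneCocycle (toGrp F) U) :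
    OneCocycle (toGrp F) U where
  toOneCochain := γ.toOneCochain * γ'.toOneCochain
  ev_trans i j k T a b c := by
    rw [OneCochain.mul_ev, OneCochain.mul_ev, OneCochain.mul_ev, ← γ.ev_trans i j k a b c,
      ← γ'.ev_trans i j k a b c]
    exact mul_mul_mul_comm (G := F.obj (Opposite.op T)) _ _ _ _

variable {U} in
/-- The pointwise inverse of a cocycle in an abelian presheaf. -/
def invCocycle {F : (Opens X)ᵒᵖ ⥤ CommGrpCat.{w}} (γ : OneCocycle (toGrp F) U) :
    OneCocycle (toGrp F) U where
  toOneCochain := γ.toOneCochain⁻¹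
  ev_trans i j k T a b c := by
    rw [OneCochain.inv_ev, OneCochain.inv_ev, OneCochain.inv_ev, ← γ.ev_trans i j k a b c]
    exact (mul_inv (α := F.obj (Opposite.op T)) _ _).symm

/-- The group structure on `Ȟ¹` of an abelian presheaf, given by multiplication of cocycles. -/
instance (F : (Opens X)ᵒᵖ ⥤ CommGrpCat.{w}) : CommGroup (CechH1 U F) where
  mul := Quot.map₂ mulCocycle
    (by
      rintro γ γ₁ γ₂ ⟨α, h⟩
      refine ⟨α, fun i j T a b => ?_⟩
      have key := congrArg (γ.ev i j a b * ·) (h i j a b)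
      refine Eq.trans ?_ (Eq.trans key ?_)
      · exact mul_left_comm (G := F.obj (Opposite.op T)) _ _ _
      · exact (mul_assoc (G := F.obj (Opposite.op T)) _ _ _).symm)
    (by
      rintro γ₁ γ₂ γ ⟨α, h⟩
      refine ⟨α, fun i j T a b => ?_⟩
      have key := congrArg (· * γ.ev i j a b) (h i j a b)
      refine Eq.trans ?_ (Eq.trans key ?_)
      · exact (mul_assoc (G := F.obj (Opposite.op T)) _ _ _).symm
      · exact mul_right_comm (G := F.obj (Opposite.op T)) _ _ _)
  inv := Quot.map invCocycle (by
    rintro γ γ' ⟨α, h⟩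
    refine ⟨α⁻¹, fun i j T a b => ?_⟩
    have key := congrArg (·⁻¹) (h i j a b)
    have key' := (mul_inv (α := F.obj (Opposite.op T)) _ _).symm.trans
      (key.trans (mul_inv (α := F.obj (Opposite.op T)) _ _))
    rw [Cochain₀.inv_apply, Cochain₀.inv_apply, map_inv, map_inv]
    exact key')
  mul_assoc := by
    rintro ⟨a⟩ ⟨b⟩ ⟨c⟩
    refine congrArg (Quot.mk _) (cocycle_ext U ?_)
    exact mul_assoc a.toOneCochain b.toOneCochain c.toOneCochain
  one_mul := by
    rintro ⟨a⟩
    refine congrArg (Quot.mk _) (cocycle_ext U ?_)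
    exact one_mul a.toOneCochain
  mul_one := by
    rintro ⟨a⟩
    refine congrArg (Quot.mk _) (cocycle_ext U ?_)
    exact mul_one a.toOneCochain
  inv_mul_cancel := by
    rintro ⟨a⟩
    refine congrArg (Quot.mk _) (cocycle_ext U ?_)
    exact inv_mul_cancel a.toOneCochain
  mul_comm := by
    rintro ⟨a⟩ ⟨b⟩
    refine congrArg (Quot.mk _) (cocycle_ext U ?_)
    ext i j T p q
    exact mul_comm (G := F.obj (Opposite.op T)) _ _

/-- The homomorphism on `Ȟ¹` induced by a morphism of presheaves of abelian groups. -/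
def mapCechH1 {F F' : (Opens X)ᵒᵖ ⥤ CommGrpCat.{w}} (φ : F ⟶ F') :
    CechH1 U F →* CechH1 U F' where
  toFun := mapH1 U (Functor.whiskerRight φ (forget₂ CommGrpCat GrpCat))
  map_one' := by
    refine congrArg (Quot.mk _) (cocycle_ext U ?_)
    ext i j T p q
    exact map_one (φ.app (Opposite.op T)).hom
  map_mul' := by
    rintro ⟨a⟩ ⟨b⟩
    refine congrArg (Quot.mk _) (cocycle_ext U ?_)
    ext i j T p q
    exact map_mul (φ.app (Opposite.op T)).hom _ _

/-- A good cover: an open cover all of whose nonempty finite intersections are contractible. -/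
structure IsGoodCover : Prop where
  covers : ∀ x : X, ∃ i, x ∈ U i
  contractible : ∀ S : Finset J, S.Nonempty → (⋂ i ∈ S, (U i : Set X)).Nonempty →
    ContractibleSpace (⋂ i ∈ S, (U i : Set X) : Set X)

end Cech

/-! ### The sheaves of groups -/

section Sheaves

variable (n M) in
/-- The sheaf `U ↦ C^∞(U)^×` of nowhere vanishing smooth functions. -/
def smoothUnits : (Opens M)ᵒᵖ ⥤ CommGrpCat.{u} where
  obj U := CommGrpCat.of (smoothFun n U.unop)ˣ
  map f := CommGrpCat.ofHom (Units.map (smoothRes (leOfHom f.unop)).toRingHom.toMonoidHom)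
  map_id _ := rfl
  map_comp _ _ := rfl

variable (n M) in
/-- The sheaf `𝒵^×`, where `𝒵(U) = C^∞(U)⟦ħ⟧` with the ordinary product. -/
def centerUnits : (Opens M)ᵒᵖ ⥤ CommGrpCat.{u} where
  obj U := CommGrpCat.of (PowerSeries (smoothFun n U.unop))ˣ
  map f := CommGrpCat.ofHom
    (Units.map (PowerSeries.map (smoothRes (leOfHom f.unop)).toRingHom).toMonoidHom)
  map_id _ := rfl
  map_comp _ _ := rfl

variable (n M) in
/-- Reduction modulo `ħ`, as a morphism `𝒵^× → (C^∞)^×`. -/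
def centerReduction : centerUnits n M ⟶ smoothUnits n M where
  app U := CommGrpCat.ofHom
    (Units.map (PowerSeries.constantCoeff (R := smoothFun n U.unop)).toMonoidHom)
  naturality U V f := by
    ext x
    refine Units.ext ?_
    change PowerSeries.constantCoeff (PowerSeries.map (smoothRes (leOfHom f.unop)).toRingHom x.1) =
      (smoothRes (leOfHom f.unop)).toRingHom (PowerSeries.constantCoeff x.1)
    rw [← PowerSeries.coeff_zero_eq_constantCoeff_apply, PowerSeries.coeff_map,
      PowerSeries.coeff_zero_eq_constantCoeff_apply]

variable [IsManifold (𝓡 (2 * n)) ∞ M] [T2Space M] {Ω : SymplecticForm n M}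

/-- The sheaf of (in general nonabelian) groups `U ↦ 𝔸_ħ(U)^×`. -/
def quantumUnits (A : DeformationQuantization Ω) : (Opens M)ᵒᵖ ⥤ GrpCat.{u} where
  obj U := GrpCat.of (A.Sections U.unop)ˣ
  map f := GrpCat.ofHom (Units.map (A.res (leOfHom f.unop)).toMonoidHom)
  map_id _ := rfl
  map_comp _ _ := rfl

/-- Reduction modulo `ħ`, as a morphism `𝔸_ħ^× → (C^∞)^×`. -/
def quantumReduction (A : DeformationQuantization Ω) :
    quantumUnits A ⟶ toGrp (smoothUnits n M) where
  app U := GrpCat.ofHom (Units.map (A.reduction U.unop).toMonoidHom)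
  naturality U V f := by
    ext x
    refine Units.ext ?_
    exact PowerSeries.coeff_map (smoothRes (leOfHom f.unop)).toRingHom 0 x.1

end Sheaves

/-! ### Constant sheaves and formal power series -/

section Constant

variable (X : Type u) [TopologicalSpace X]

/-- The constant sheaf with value an abelian group `G`: locally constant functions. -/
def constSheaf (G : Type) [CommGroup G] : (Opens X)ᵒᵖ ⥤ CommGrpCat.{u} where
  obj U := CommGrpCat.of (LocallyConstant U.unop G)
  map f := CommGrpCat.ofHom
    { toFun := LocallyConstant.comap
        ⟨Opens.inclusion (leOfHom f.unop), continuous_inclusion (leOfHom f.unop)⟩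
      map_one' := rfl
      map_mul' := fun _ _ => rfl }
  map_id _ := rfl
  map_comp _ _ := rfl

/-- The morphism of constant sheaves induced by a group homomorphism. -/
def constSheafMap {G G' : Type} [CommGroup G] [CommGroup G'] (φ : G →* G') :
    constSheaf X G ⟶ constSheaf X G' where
  app U := CommGrpCat.ofHom
    { toFun := LocallyConstant.map φ
      map_one' := by
        ext x
        exact map_one φ
      map_mul' := fun f g => by
        ext x
        exact map_mul φ (f x) (g x) }
  naturality _ _ _ := rfl

/-- The additive group `ħℂ⟦ħ⟧`. -/
def hbarSeries : AddSubgroup (PowerSeries ℂ) :=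
  (PowerSeries.constantCoeff (R := ℂ)).toAddMonoidHom.ker

/-- The multiplicative group `1 + ħℂ⟦ħ⟧`. -/
def oneAddHbarSeries : Subgroup (PowerSeries ℂ)ˣ :=
  (Units.map (PowerSeries.constantCoeff (R := ℂ)).toMonoidHom).ker

/-- The exponential `∑ fᵏ / k!` of a formal power series `f`. -/
def expSeries (f : PowerSeries ℂ) : PowerSeries ℂ := (PowerSeries.exp ℂ).subst f

theorem hasSubst_of_mem {f : PowerSeries ℂ} (hf : f ∈ hbarSeries) : PowerSeries.HasSubst f :=
  PowerSeries.HasSubst.of_constantCoeff_zero' hf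

theorem constantCoeff_expSeries {f : PowerSeries ℂ} (hf : f ∈ hbarSeries) :
    PowerSeries.constantCoeff (expSeries f) = 1 := by
  have h : PowerSeries.constantCoeff ((PowerSeries.exp ℂ - 1).subst f) = 0 :=
    PowerSeries.constantCoeff_subst_eq_zero hf _ (by simp)
  have hs := hasSubst_of_mem hf
  have h1 : (1 : PowerSeries ℂ).subst f = (1 : PowerSeries ℂ) := by
    rw [← PowerSeries.coe_substAlgHom hs, map_one]
  rw [PowerSeries.subst_sub hs, h1, map_sub, map_one, sub_eq_zero] at h
  exact h

theorem derivative_expSeries {f : PowerSeries ℂ} (hf : f ∈ hbarSeries) :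
    PowerSeries.derivative ℂ (expSeries f) = expSeries f * PowerSeries.derivative ℂ f := by
  rw [expSeries, PowerSeries.derivative_subst (hasSubst_of_mem hf), PowerSeries.derivative_exp]

theorem expSeries_zero : expSeries 0 = 1 := by
  refine PowerSeries.derivative.ext ?_ ?_
  · rw [derivative_expSeries (zero_mem _)]
    simp
  · rw [constantCoeff_expSeries (zero_mem _), map_one]

theorem expSeries_mul_neg {f : PowerSeries ℂ} (hf : f ∈ hbarSeries) :
    expSeries f * expSeries (-f) = 1 := by
  refine PowerSeries.derivative.ext ?_ ?_
  · rw [Derivation.leibniz, derivative_expSeries hf, derivative_expSeries (neg_mem hf)]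
    simp only [smul_eq_mul, map_neg, PowerSeries.derivative_one]
    ring
  · rw [map_mul, constantCoeff_expSeries hf, constantCoeff_expSeries (neg_mem hf), map_one, one_mul]

theorem expSeries_add {f g : PowerSeries ℂ} (hf : f ∈ hbarSeries) (hg : g ∈ hbarSeries) :
    expSeries (f + g) = expSeries f * expSeries g := by
  have hfg := add_mem hf hg
  have h : expSeries f * expSeries g * expSeries (-(f + g)) = 1 := by
    refine PowerSeries.derivative.ext ?_ ?_
    · rw [Derivation.leibniz, Derivation.leibniz, derivative_expSeries hf, derivative_expSeries hg,
        derivative_expSeries (neg_mem hfg)]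
      simp only [smul_eq_mul, map_neg, map_add, PowerSeries.derivative_one]
      ring
    · rw [map_mul, map_mul, constantCoeff_expSeries hf, constantCoeff_expSeries hg,
        constantCoeff_expSeries (neg_mem hfg), map_one, one_mul, one_mul]
  calc expSeries (f + g) = expSeries f * expSeries g * expSeries (-(f + g)) * expSeries (f + g) := by
        rw [h, one_mul]
    _ = expSeries f * expSeries g * (expSeries (f + g) * expSeries (-(f + g))) := by ring
    _ = expSeries f * expSeries g := by rw [expSeries_mul_neg hfg, mul_one]

/-- The homomorphism `exp : (ħℂ⟦ħ⟧, +) → (1 + ħℂ⟦ħ⟧, ·)`. -/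
def expHom : Multiplicative hbarSeries →* oneAddHbarSeries where
  toFun f := ⟨⟨expSeries f.toAdd.1, expSeries (-f.toAdd.1), expSeries_mul_neg f.toAdd.2, by
    rw [mul_comm, expSeries_mul_neg f.toAdd.2]⟩,
    Units.ext (constantCoeff_expSeries f.toAdd.2)⟩
  map_one' := Subtype.ext (Units.ext expSeries_zero)
  map_mul' f g := Subtype.ext (Units.ext (expSeries_add f.toAdd.2 g.toAdd.2))

/-- The homomorphism `ħℂ⟦ħ⟧ → ℂ` that takes the coefficient of `ħᵏ`. -/
def coeffHom (k : ℕ) : Multiplicative hbarSeries →* Multiplicative ℂ :=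
  AddMonoidHom.toMultiplicative
    ((PowerSeries.coeff (R := ℂ) k).toAddMonoidHom.comp hbarSeries.subtype)

/-- `ħH⟦ħ⟧` for an abelian group `H`: sequences of coefficients in `H` with zero constant term. -/
def formalHbar (H : Type*) [AddCommGroup H] : AddSubgroup (ℕ → H) where
  carrier := {c | c 0 = 0}
  add_mem' {a b} ha hb := by
    change a 0 + b 0 = 0
    rw [ha, hb, add_zero]
  zero_mem' := rfl
  neg_mem' {a} ha := by
    change -a 0 = 0
    rw [ha, neg_zero]

/-- The additive group `Ȟ¹(𝓤, ℂ)`. -/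
abbrev CechH1Complex {X : Type u} [TopologicalSpace X] {J : Type v} (U : J → Opens X) :=
  Additive (CechH1 U (constSheaf X (Multiplicative ℂ)))

end Constant

end DefQuant

end

open DefQuant

noncomputable section

namespace DefQuant

universe u v w

variable {n : ℕ} {M : Type u} [TopologicalSpace M] [ChartedSpace (E n) M]

/-! ### Gluing of smooth functions -/

/-! Statements 1 and 2 are one fact about a sheaf of possibly noncommutative rings 𝒮 that reduces to
`C^∞`, detects units by the reduction, and has a section `lift` of the reduction (`RingSheafOver`).
Let `c_ij` be a cocycle whose reduction is trivialized by invertible `w_i`, so `w_i red(c_ij) =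
w_j`. With a partition of unity `ρ_k` subordinate to the cover, put `a_i = ∑_k lift(ρ_k w_k) c_ki`.
The cocycle identity gives `a_i c_ij = a_j`, and `red a_i = ∑_k ρ_k w_k red(c_ki) = ∑_k ρ_k w_i =
w_i`, so `a_i` is invertible and `c` is a coboundary (`exists_isUnit_mul_eq`). No induction on
powers of ħ is needed, and no commutativity, since `c` multiplies only on the right. For 𝔸_ħ,
detection of units is a recursive solution of `f ⋆ g = 1`. For 𝒵 the constant series moreover form a
subring, which gives surjectivity of `P₁`; injectivity is triviality of the kernel of a
homomorphism.

Statement 3 rests on two bijections. The formal exponential is an isomorphism of groups, hence one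
on cohomology of constant sheaves. The coefficient map `cechCoeff` is bijective because `U_i` and
`U_i ∩ U_j` are connected or empty: sections there are constants, and any sequence of constants is
the coefficient sequence of a single series. `P₃` is `cechCoeff` after the inverse of `exp_*`. Only
this part uses contractibility. -/

/-- Smooth functions glue. -/
theorem exists_smoothFun_glue {U : Opens M} (W : U → Opens M) (hW : ∀ x, W x ≤ U)
    (mem : ∀ x : U, x.1 ∈ W x) (s : ∀ x, smoothFun n (W x))
    (compat : ∀ x y, smoothRes (inf_le_left : W x ⊓ W y ≤ W x) (s x) =
      smoothRes (inf_le_right : W x ⊓ W y ≤ W y) (s y)) :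
    ∃ t : smoothFun n U, ∀ x, smoothRes (hW x) t = s x := by
  -- The glued function takes at each point the value of the section indexed by that point. On all
  -- of `W x` it agrees with `s x`.
  have key : ∀ (x : U) (y : W x), (s ⟨y.1, hW x y.2⟩).1 ⟨y.1, mem ⟨y.1, hW x y.2⟩⟩ =
      (s x).1 y := by
    intro x y
    have h := compat ⟨y.1, hW x y.2⟩ x
    exact congrFun (congrArg Subtype.val h) ⟨y.1, mem ⟨y.1, hW x y.2⟩, y.2⟩
  refine ⟨⟨fun x => (s x).1 ⟨x.1, mem x⟩, fun x => ?_⟩, fun x => ?_⟩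
  · classical
    -- Extension by zero to `M` lets smoothness on `W x` and on `U` be compared: both are smoothness
    -- of `g` at the same point of `M`.
    let g : M → ℂ := fun y => if h : y ∈ U then (s ⟨y, h⟩).1 ⟨y, mem ⟨y, h⟩⟩ else 0
    have h1 : ContMDiffAt (𝓡 (2 * n)) 𝓘(ℝ, ℂ) ∞ (fun z : W x => g z) ⟨x.1, mem x⟩ := by
      have : (fun z : W x => g z) = (s x).1 := by
        funext z
        simp only [g]
        rw [dif_pos (hW x z.2)]
        exact key x z
      rw [this]
      exact (s x).2 _
    have h2 : ContMDiffAt (𝓡 (2 * n)) 𝓘(ℝ, ℂ) ∞ (fun z : U => g z) x :=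
      contMDiffAt_subtype_iff.2 ((contMDiffAt_subtype_iff (f := g) (x := ⟨x.1, mem x⟩)).1 h1)
    have : (fun z : U => (s z).1 ⟨z.1, mem z⟩) = fun z : U => g z := by
      funext z
      simp only [g]
      rw [dif_pos z.2]
    rw [this]
    exact h2
  · ext y
    exact key x y

/-- Formal power series of smooth functions glue. -/
theorem exists_series_glue {U : Opens M} (W : U → Opens M) (hW : ∀ x, W x ≤ U)
    (mem : ∀ x : U, x.1 ∈ W x) (s : ∀ x, PowerSeries (smoothFun n (W x)))
    (compat : ∀ x y, PowerSeries.map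
        (smoothRes (n := n) (inf_le_left : W x ⊓ W y ≤ W x)).toRingHom (s x) =
      PowerSeries.map (smoothRes (inf_le_right : W x ⊓ W y ≤ W y)).toRingHom (s y)) :
    ∃ t : PowerSeries (smoothFun n U), ∀ x,
      PowerSeries.map (smoothRes (hW x)).toRingHom t = s x := by
  have h : ∀ m, ∃ t : smoothFun n U, ∀ x,
      smoothRes (hW x) t = PowerSeries.coeff m (s x) := by
    intro m
    refine exists_smoothFun_glue W hW mem _ fun x y => ?_
    have := congrArg (PowerSeries.coeff m) (compat x y)
    rw [PowerSeries.coeff_map, PowerSeries.coeff_map] at this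
    exact this
  choose t ht using h
  refine ⟨PowerSeries.mk t, fun x => ?_⟩
  ext1 m
  rw [PowerSeries.coeff_map, PowerSeries.coeff_mk]
  exact ht m x

/-- Formal power series of smooth functions that agree locally agree. -/
theorem series_separated {U : Opens M} {s t : PowerSeries (smoothFun n U)}
    (h : ∀ x : U, ∃ (W : Opens M) (hW : W ≤ U), x.1 ∈ W ∧
      PowerSeries.map (smoothRes (n := n) hW).toRingHom s =
        PowerSeries.map (smoothRes hW).toRingHom t) : s = t := by
  ext m x
  obtain ⟨W, hW, hx, e⟩ := h x
  have := congrArg (PowerSeries.coeff m) e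
  rw [PowerSeries.coeff_map, PowerSeries.coeff_map] at this
  exact congrFun (congrArg Subtype.val this) ⟨x.1, hx⟩

/-! ### Sheaves of rings over the sheaf of smooth functions -/

variable (n M) in
/-- A sheaf of (in general noncommutative) rings with a reduction to the sheaf of smooth functions
which detects units and has an additive section. -/
structure RingSheafOver where
  /-- the sections -/
  S : Opens M → Type u
  [ring : ∀ V, Ring (S V)]
  /-- the restriction maps -/
  res : ∀ {U V : Opens M}, V ≤ U → S U →+* S V
  res_res : ∀ {U V W : Opens M} (h : V ≤ U) (h' : W ≤ V) (s : S U),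
    res h' (res h s) = res (h'.trans h) s
  /-- the reduction -/
  red : ∀ V : Opens M, S V →+* smoothFun n V
  red_res : ∀ {U V : Opens M} (h : V ≤ U) (s : S U), red V (res h s) = smoothRes h (red U s)
  /-- the section of the reduction -/
  lift : ∀ V : Opens M, smoothFun n V →+ S V
  lift_res : ∀ {U V : Opens M} (h : V ≤ U) (f : smoothFun n U),
    res h (lift U f) = lift V (smoothRes h f)
  red_lift : ∀ V f, red V (lift V f) = f
  isUnit_of_red : ∀ V s, IsUnit (red V s) → IsUnit s
  glue : ∀ {U : Opens M} (W : U → Opens M) (hW : ∀ x, W x ≤ U), (∀ x : U, x.1 ∈ W x) →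
    ∀ s : ∀ x, S (W x), (∀ x y, res (inf_le_left : W x ⊓ W y ≤ W x) (s x) =
      res (inf_le_right : W x ⊓ W y ≤ W y) (s y)) → ∃ t : S U, ∀ x, res (hW x) t = s x
  separated : ∀ {U : Opens M} {s t : S U}, (∀ x : U, ∃ (W : Opens M) (hW : W ≤ U), x.1 ∈ W ∧
    res hW s = res hW t) → s = t

attribute [instance] RingSheafOver.ring

/-- A smooth real function on `M` as a complex valued function on an open set. -/
def restrictReal (ρ : C^∞⟮𝓡 (2 * n), M; 𝓘(ℝ, ℝ), ℝ⟯) (V : Opens M) : smoothFun n V :=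
  ⟨fun x => (ρ x : ℂ), by
    have h : ContMDiff 𝓘(ℝ, ℝ) 𝓘(ℝ, ℂ) ∞ (fun r : ℝ => (r : ℂ)) :=
      Complex.ofRealCLM.contDiff.contMDiff
    exact h.comp (ρ.contMDiff.comp contMDiff_subtype_val)⟩

/-! ### Trivializing a cocycle by a partition of unity -/

namespace RingSheafOver

variable (𝒮 : RingSheafOver n M) {J : Type v} {U : J → Opens M}

/-- A 1-cocycle with values in the multiplicative monoids of sections. -/
structure Cocycle (U : J → Opens M) where
  /-- the sections -/
  c : ∀ (i j : J) {T : Opens M}, T ≤ U i → T ≤ U j → 𝒮.S T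
  res_c : ∀ (i j : J) {T T' : Opens M} (h : T' ≤ T) (hi : T ≤ U i) (hj : T ≤ U j),
    𝒮.res h (c i j hi hj) = c i j (h.trans hi) (h.trans hj)
  mul_c : ∀ (i j k : J) {T : Opens M} (hi : T ≤ U i) (hj : T ≤ U j) (hk : T ≤ U k),
    c i j hi hj * c j k hj hk = c i k hi hk

namespace Cocycle

variable {𝒮}
variable (γ : 𝒮.Cocycle U) (ρ : J → C^∞⟮𝓡 (2 * n), M; 𝓘(ℝ, ℝ), ℝ⟯)
  (w : ∀ i, smoothFun n (U i))

open Classical in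
/-- The section `ρ_k w_k c_{ki}`. -/
def term (k i : J) (W : Opens M) (hi : W ≤ U i) : 𝒮.S W :=
  -- The default 0 makes the term available for every `k`; the sums that are glued below run only
  -- over `k` with `W ≤ U k`.
  if hk : W ≤ U k then
    𝒮.lift W (restrictReal (ρ k) W * smoothRes hk (w k)) * γ.c k i hk hi
  else 0

theorem res_term (k i : J) {W W' : Opens M} (h : W' ≤ W) (hi : W ≤ U i) (hk : W ≤ U k) :
    𝒮.res h (γ.term ρ w k i W hi) = γ.term ρ w k i W' (h.trans hi) := by
  rw [term, term, dif_pos hk, dif_pos (h.trans hk), map_mul, γ.res_c, 𝒮.lift_res]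
  rfl

/-- This allows the finite index set of a local sum to be enlarged, so that sums over different sets
can be compared on an overlap. -/
theorem term_eq_zero (k i : J) (W : Opens M) (hi : W ≤ U i) (h0 : ∀ x ∈ W, ρ k x = 0) :
    γ.term ρ w k i W hi = 0 := by
  have : restrictReal (ρ k) W = 0 := by
    ext x
    change ((ρ k x : ℝ) : ℂ) = 0
    rw [h0 x x.2, Complex.ofReal_zero]
  rw [term]
  split_ifs
  · rw [this, zero_mul, map_zero, zero_mul]
  · rfl

/-- This is `c_ki c_ij = c_kj`; the lifted factor stays on the left, so nothing has to commute. -/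
theorem term_mul (k i j : J) (W : Opens M) (hi : W ≤ U i) (hj : W ≤ U j) :
    γ.term ρ w k i W hi * γ.c i j hi hj = γ.term ρ w k j W hj := by
  rw [term, term]
  split_ifs with hk
  · rw [mul_assoc, γ.mul_c]
  · rw [zero_mul]

/-- Because `w` trivializes the reduced cocycle, `w_k red(c_ki) = w_i` no longer depends on `k`, and
summing over `k` leaves `(∑ ρ_k) w_i`. -/
theorem red_term (k i : J) (W : Opens M) (hi : W ≤ U i) (hk : W ≤ U k)
    (hw : smoothRes hk (w k) * 𝒮.red W (γ.c k i hk hi) = smoothRes hi (w i)) :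
    𝒮.red W (γ.term ρ w k i W hi) = restrictReal (ρ k) W * smoothRes hi (w i) := by
  rw [term, dif_pos hk, map_mul, 𝒮.red_lift, mul_assoc, hw]

variable {γ ρ w} in
/-- Local sums over finite sets of indices agree on overlaps. -/
theorem res_sum_term {i : J} {W W' : Opens M} (h : W' ≤ W) (hi : W ≤ U i) (F F' : Finset J)
    (hF : ∀ k ∈ F, W ≤ U k) (hF' : ∀ k ∉ F, ∀ x ∈ W, ρ k x = 0) (hFF : F ⊆ F') :
    𝒮.res h (∑ k ∈ F, γ.term ρ w k i W hi) = ∑ k ∈ F', γ.term ρ w k i W' (h.trans hi) := by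
  rw [map_sum, ← Finset.sum_subset hFF fun k _ hk =>
    γ.term_eq_zero ρ w k i W' (h.trans hi) fun x hx => hF' k hk x (h hx)]
  exact Finset.sum_congr rfl fun k hk => γ.res_term ρ w k i h hi (hF k hk)

/-- A cocycle with values in `𝒮` whose reduction is a coboundary is a coboundary. -/
theorem exists_isUnit_mul_eq [T2Space M] [SecondCountableTopology M]
    [IsManifold (𝓡 (2 * n)) ∞ M] (hU : ∀ x, ∃ i, x ∈ U i)
    (hu : ∀ i, IsUnit (w i))
    (hw : ∀ (i j : J) {T : Opens M} (hi : T ≤ U i) (hj : T ≤ U j),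
      smoothRes hi (w i) * 𝒮.red T (γ.c i j hi hj) = smoothRes hj (w j)) :
    ∃ a : ∀ i, 𝒮.S (U i), (∀ i, IsUnit (a i)) ∧
      ∀ (i j : J) {T : Opens M} (hi : T ≤ U i) (hj : T ≤ U j),
        𝒮.res hi (a i) * γ.c i j hi hj = 𝒮.res hj (a j) := by
  classical
  have : LocallyCompactSpace M := ChartedSpace.locallyCompactSpace (E n) M
  have : SigmaCompactSpace M := sigmaCompactSpace_of_locallyCompact_secondCountable
  obtain ⟨P, hP⟩ := SmoothPartitionOfUnity.exists_isSubordinate (𝓡 (2 * n)) isClosed_univ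
    (fun i => (U i : Set M)) (fun i => (U i).isOpen)
    (fun x _ => Set.mem_iUnion.2 (hU x))
  let ρ : J → C^∞⟮𝓡 (2 * n), M; 𝓘(ℝ, ℝ), ℝ⟯ := fun i => P i
  -- Infinite sums make no sense in 𝒮. Near each point only finitely many `ρ_k` are nonzero, and a
  -- small neighbourhood lies in the corresponding `U k`, so finite sums suffice locally.
  have local_data : ∀ x : M, ∃ (F : Finset J) (W : Opens M), x ∈ W ∧ (∀ k ∈ F, W ≤ U k) ∧
      ∀ k ∉ F, ∀ y ∈ W, ρ k y = 0 := by
    intro x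
    obtain ⟨F, N, hN, hF, hs⟩ := P.toPartitionOfUnity.exists_finset_nhds_support_subset hP
      (fun i => (U i).isOpen) x
    obtain ⟨W, hWN, hWo, hx⟩ := mem_nhds_iff.1 hN
    refine ⟨F, ⟨W, hWo⟩, hx, fun k hk y hy => Set.mem_iInter₂.1 (hF (hWN hy)) k hk,
      fun k hk y hy => ?_⟩
    by_contra h0
    exact hk (hs y (hWN hy) h0)
  choose F W hxW hFU hF0 using local_data
  -- The sections `a_i = ∑_k lift(ρ_k w_k) c_ki`; on overlaps both local sums equal the sum over the
  -- union of the index sets.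
  have glued : ∀ i, ∃ t : 𝒮.S (U i), ∀ x : U i,
      𝒮.res (inf_le_right : W x.1 ⊓ U i ≤ U i) t =
        ∑ k ∈ F x.1, γ.term ρ w k i (W x.1 ⊓ U i) inf_le_right := by
    intro i
    refine 𝒮.glue (fun x : U i => W x.1 ⊓ U i) (fun x => inf_le_right)
      (fun x => ⟨hxW x.1, x.2⟩) _ fun x y => ?_
    rw [res_sum_term _ _ (F x.1) (F x.1 ∪ F y.1) (fun k hk => inf_le_left.trans (hFU x.1 k hk))
        (fun k hk z hz => hF0 x.1 k hk z hz.1) Finset.subset_union_left,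
      res_sum_term _ _ (F y.1) (F x.1 ∪ F y.1) (fun k hk => inf_le_left.trans (hFU y.1 k hk))
        (fun k hk z hz => hF0 y.1 k hk z hz.1) Finset.subset_union_right]
  choose a ha using glued
  -- With `V` arbitrary, `a_i` and `a_j` expand near `x` over the same set `F x`, and `a_i c_ij =
  -- a_j` can be checked term by term.
  have ha' : ∀ (i : J) (x : M) (V : Opens M) (hV : V ≤ W x) (hi : V ≤ U i) (hx : x ∈ U i),
      𝒮.res hi (a i) = ∑ k ∈ F x, γ.term ρ w k i V hi := by
    intro i x V hV hi hx
    rw [← 𝒮.res_res (inf_le_right : W x ⊓ U i ≤ U i) (le_inf hV hi), ha i ⟨x, hx⟩,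
      res_sum_term _ _ (F x) (F x) (fun k hk => inf_le_left.trans (hFU x k hk))
        (fun k hk z hz => hF0 x k hk z hz.1) subset_rfl]
  refine ⟨a, fun i => 𝒮.isUnit_of_red _ _ ?_, fun i j T hi hj => 𝒮.separated fun x => ?_⟩
  -- The goal becomes `red a_i = w_i`, checked at each point `x` by means of `∑ ρ_k = 1`.
  · convert hu i
    ext x
    have hred := congrArg (𝒮.red (W x.1 ⊓ U i)) (ha i x)
    rw [𝒮.red_res, map_sum, Finset.sum_congr rfl fun k hk => γ.red_term ρ w k i (W x.1 ⊓ U i)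
      inf_le_right (inf_le_left.trans (hFU x.1 k hk)) (hw k i _ _), ← Finset.sum_mul] at hred
    have hx := congrFun (congrArg Subtype.val hred) ⟨x.1, hxW x.1, x.2⟩
    have hone : (∑ k ∈ F x.1, (restrictReal (ρ k) (W x.1 ⊓ U i) : smoothFun n _)).1
        ⟨x.1, hxW x.1, x.2⟩ = 1 := by
      have h1 := P.sum_eq_one (Set.mem_univ x.1)
      rw [finsum_eq_sum_of_support_subset (s := F x.1)] at h1
      · rw [AddSubmonoidClass.coe_finsetSum, Finset.sum_apply, ← Complex.ofReal_one, ← h1,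
          Complex.ofReal_sum]
        rfl
      · intro k hk
        by_contra hkF
        exact hk (hF0 x.1 k hkF x.1 (hxW x.1))
    refine hx.trans ?_
    refine (congrArg (· * (w i).1 x) hone).trans ?_
    exact one_mul _
  · refine ⟨W x.1 ⊓ T, inf_le_right, ⟨hxW x.1, x.2⟩, ?_⟩
    rw [map_mul, 𝒮.res_res, 𝒮.res_res, γ.res_c,
      ha' i x.1 _ inf_le_left (inf_le_right.trans hi) (hi x.2),
      ha' j x.1 _ inf_le_left (inf_le_right.trans hj) (hj x.2), Finset.sum_mul]
    exact Finset.sum_congr rfl fun k _ => γ.term_mul ρ w k i j _ _ _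

end Cocycle

end RingSheafOver

/-! ### From cocycles to first cohomology of the units -/

namespace RingSheafOver

variable (𝒮 : RingSheafOver n M)

/-- The presheaf of groups of invertible sections. -/
def units : (Opens M)ᵒᵖ ⥤ GrpCat.{u} where
  obj V := GrpCat.of (𝒮.S V.unop)ˣ
  map f := GrpCat.ofHom (Units.map (𝒮.res (leOfHom f.unop)).toMonoidHom)
  map_id V := by
    ext s
    -- Identity restrictions are not an axiom of the structure: `res_res` makes them idempotent, and
    -- separatedness then makes them trivial.
    have h : 𝒮.res le_rfl s.1 = s.1 :=
      𝒮.separated fun x => ⟨V.unop, le_rfl, x.2, 𝒮.res_res _ _ _⟩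
    exact h
  map_comp f g := by
    ext s
    exact (𝒮.res_res _ _ s.1).symm

/-- The reduction of invertible sections. -/
def unitsRed : 𝒮.units ⟶ toGrp (smoothUnits n M) where
  app V := GrpCat.ofHom (Units.map (𝒮.red V.unop).toMonoidHom)
  naturality V W f := by
    ext s
    exact Units.ext (𝒮.red_res _ _)

open PresheafOfGroups in
/-- The map on `Ȟ¹` induced by the reduction of invertible sections has trivial kernel. -/
theorem eq_one_of_mapH1_unitsRed_eq_one [T2Space M] [SecondCountableTopology M]
    [IsManifold (𝓡 (2 * n)) ∞ M] {J : Type v} {U : J → Opens M} (hU : ∀ x, ∃ i, x ∈ U i)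
    (c : H1 𝒮.units U) (hc : mapH1 U 𝒮.unitsRed c = 1) : c = 1 := by
  obtain ⟨γ⟩ := c
  obtain ⟨α, hα⟩ := (OneCocycle.class_eq_iff (mapCocycle U 𝒮.unitsRed γ) 1).1 hc
  let δ : 𝒮.Cocycle U :=
    { c := fun i j T hi hj => (γ.ev i j (homOfLE hi) (homOfLE hj)).1
      res_c := fun i j T T' h hi hj =>
        congrArg Units.val (γ.ev_precomp i j (homOfLE h) (homOfLE hi) (homOfLE hj))
      mul_c := fun i j k T hi hj hk =>
        congrArg Units.val (γ.ev_trans i j k (homOfLE hi) (homOfLE hj) (homOfLE hk)) }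
  obtain ⟨a, ha, h⟩ := δ.exists_isUnit_mul_eq (fun i => (α i).1) hU (fun i => (α i).isUnit)
    fun i j T hi hj => by
      have := congrArg Units.val (hα i j (homOfLE hi) (homOfLE hj))
      exact this.trans (one_mul _)
  refine (OneCocycle.class_eq_iff γ 1).2 ⟨fun i => (ha i).unit, fun i j T p q => Units.ext ?_⟩
  exact (h i j (leOfHom p) (leOfHom q)).trans (one_mul _).symm

end RingSheafOver

/-! ### Invertibility for star products -/

section Star

variable {R : Type*} [CommRing R] [Algebra ℂ R] (B : ℕ → R →ₗ[ℂ] R →ₗ[ℂ] R)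

theorem coeff_starMul_congr_right {f g g' : PowerSeries R} {m : ℕ}
    (h : ∀ k ≤ m, PowerSeries.coeff k g = PowerSeries.coeff k g') :
    PowerSeries.coeff m (starMul B f g) = PowerSeries.coeff m (starMul B f g') := by
  rw [coeff_starMul, coeff_starMul]
  refine Finset.sum_congr rfl fun p hp => Finset.sum_congr rfl fun q hq => ?_
  rw [Finset.HasAntidiagonal.mem_antidiagonal] at hp hq
  rw [h q.2 (by omega)]

/-- In degree `m`, the coefficient of index `m` of the right factor can occur only with `B_0` and
the constant coefficient of `f`: all degrees are used up. -/
theorem coeff_starMul_add_monomial (f g : PowerSeries R) (m : ℕ) (r : R) :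
    PowerSeries.coeff m (starMul B f (g + PowerSeries.monomial m r)) =
      PowerSeries.coeff m (starMul B f g) + B 0 (PowerSeries.coeff 0 f) r := by
  have h : ∀ p ∈ Finset.HasAntidiagonal.antidiagonal m, ∀ q ∈ Finset.HasAntidiagonal.antidiagonal p.2, q ≠ (0, m) →
      q.2 ≠ m := by
    intro p hp q hq hne h2
    rw [Finset.HasAntidiagonal.mem_antidiagonal] at hp hq
    exact hne (Prod.ext (by omega) h2)
  simp only [coeff_starMul, map_add, Finset.sum_add_distrib]
  congr 1
  rw [Finset.sum_eq_single (0, m), Finset.sum_eq_single (0, m)]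
  · rw [PowerSeries.coeff_monomial_same]
  · intro q hq hne
    rw [PowerSeries.coeff_monomial, if_neg (h (0, m) (by simp) q hq hne), map_zero]
  · simp
  · intro p hp hne
    refine Finset.sum_eq_zero fun q hq => ?_
    rw [PowerSeries.coeff_monomial, if_neg, map_zero]
    intro h2
    rw [Finset.HasAntidiagonal.mem_antidiagonal] at hp hq
    exact hne (Prod.ext (by omega) (by omega))
  · simp

/-- The coefficients of a right inverse of `f` for the star product, where `v` is the inverse of
the constant coefficient of `f`. -/
def starInvCoeff (f : PowerSeries R) (v : R) (m : ℕ) : R :=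
  v * (PowerSeries.coeff m 1 - PowerSeries.coeff m (starMul B f
    (PowerSeries.mk fun k => if _h : k < m then starInvCoeff f v k else 0)))
termination_by m

-- The degree `m` part of `f ⋆ g = 1` is affine in the unknown `g_m` with leading coefficient `f_0`,
-- so multiplying by `v` solves it once the lower coefficients are known.
variable {B} in
theorem exists_starMul_eq_one (hB : ∀ f g, B 0 f g = f * g) {f : PowerSeries R} {v : R}
    (hv : PowerSeries.coeff 0 f * v = 1) : ∃ g, starMul B f g = 1 := by
  refine ⟨PowerSeries.mk (starInvCoeff B f v), ?_⟩
  ext m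
  -- Up to degree `m` the inverse is its truncation below `m` plus its degree `m` monomial.
  rw [coeff_starMul_congr_right B (g' := (PowerSeries.mk fun k =>
    if _h : k < m then starInvCoeff B f v k else 0) +
      PowerSeries.monomial m (starInvCoeff B f v m)), coeff_starMul_add_monomial, hB,
    starInvCoeff, ← mul_assoc, hv, one_mul, add_sub_cancel]
  intro k hk
  rw [map_add, PowerSeries.coeff_mk, PowerSeries.coeff_mk, PowerSeries.coeff_monomial]
  rcases hk.lt_or_eq with h | rfl
  · rw [dif_pos h, if_neg h.ne, add_zero]
  · rw [dif_neg (lt_irrefl _), if_pos rfl, zero_add]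

end Star

/-! ### The sheaves 𝔸_ħ and 𝒵 and their cohomology -/

section

variable [IsManifold (𝓡 (2 * n)) ∞ M] [T2Space M] {Ω : SymplecticForm n M}

/-- An element of `𝔸_ħ(U)` is invertible if it is invertible modulo `ħ`. -/
theorem DeformationQuantization.isUnit_of_isUnit_reduction (A : DeformationQuantization Ω)
    (V : Opens M) (s : A.Sections V) (hs : IsUnit (A.reduction V s)) : IsUnit s := by
  have key : ∀ f : A.Sections V, IsUnit (A.reduction V f) → ∃ g, f * g = 1 := by
    intro f hf
    obtain ⟨v, hv⟩ := hf.exists_right_inv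
    exact exists_starMul_eq_one (A.BOn_zero V) hv
  obtain ⟨g, hg⟩ := key s hs
  -- The right inverse `g` also reduces to a unit, so it has a right inverse `t`; having left
  -- inverse `s` and right inverse `t` forces `s = t`.
  have hr : A.reduction V s * A.reduction V g = 1 := by rw [← map_mul, hg, map_one]
  obtain ⟨t, ht⟩ := key g (IsUnit.of_mul_eq_one_right _ hr)
  have hst : s = t := by rw [← mul_one s, ← ht, ← mul_assoc, hg, one_mul]
  exact ⟨⟨s, g, hg, by rw [hst, ht]⟩, rfl⟩

/-- The sheaf `𝔸_ħ` over the sheaf of smooth functions. -/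
def quantumSheaf (A : DeformationQuantization Ω) : RingSheafOver n M where
  S := A.Sections
  res := A.res
  res_res _ _ _ := rfl
  red := A.reduction
  red_res h s := PowerSeries.coeff_map (smoothRes h).toRingHom 0 s
  -- Constant series are additive in the function but in general not multiplicative for ⋆.
  lift V := (PowerSeries.C (R := smoothFun n V)).toAddMonoidHom
  lift_res h f := PowerSeries.map_C (smoothRes (n := n) h).toRingHom f
  red_lift _ f := PowerSeries.coeff_zero_C f
  isUnit_of_red := A.isUnit_of_isUnit_reduction
  glue := exists_series_glue
  separated := series_separated

end

variable (n M) in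
/-- The sheaf `𝒵` over the sheaf of smooth functions. -/
def centerSheaf : RingSheafOver n M where
  S V := PowerSeries (smoothFun n V)
  res h := PowerSeries.map (smoothRes h).toRingHom
  res_res _ _ _ := rfl
  red _ := PowerSeries.constantCoeff
  red_res h s := by
    rw [← PowerSeries.coeff_zero_eq_constantCoeff_apply, PowerSeries.coeff_map,
      PowerSeries.coeff_zero_eq_constantCoeff_apply]
    rfl
  lift V := (PowerSeries.C (R := smoothFun n V)).toAddMonoidHom
  lift_res h f := PowerSeries.map_C (smoothRes (n := n) h).toRingHom f
  red_lift _ f := PowerSeries.constantCoeff_C f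
  isUnit_of_red _ _ := PowerSeries.isUnit_iff_constantCoeff.2
  glue := exists_series_glue
  separated := series_separated

variable (n M) in
/-- The inclusion of the constant power series, as a morphism `(C^∞)^× → 𝒵^×`. -/
def centerInclusion : smoothUnits n M ⟶ centerUnits n M where
  app V := CommGrpCat.ofHom (Units.map (PowerSeries.C (R := smoothFun n V.unop)).toMonoidHom)
  naturality V W f := by
    ext s
    exact Units.ext (PowerSeries.map_C (smoothRes (n := n) (leOfHom f.unop)).toRingHom s.1).symm

/-- Reduction modulo `ħ` induces an isomorphism on the first cohomology of `𝒵^×`. -/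
theorem bijective_mapCechH1_centerReduction [T2Space M] [SecondCountableTopology M]
    [IsManifold (𝓡 (2 * n)) ∞ M] {J : Type v} {U : J → Opens M} (hU : ∀ x, ∃ i, x ∈ U i) :
    Function.Bijective (mapCechH1 U (centerReduction n M)) := by
  refine ⟨(injective_iff_map_eq_one _).2 fun c hc =>
    (centerSheaf n M).eq_one_of_mapH1_unitsRed_eq_one hU c hc, ?_⟩
  rintro ⟨γ⟩
  -- For the ordinary product the constant series split the reduction multiplicatively, so they
  -- carry cocycles to cocycles.
  refine ⟨mapCechH1 U (centerInclusion n M) (Quot.mk _ γ),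
    congrArg (Quot.mk _) (cocycle_ext U ?_)⟩
  ext i j T p q
  exact Units.ext (PowerSeries.constantCoeff_C _)

/-- Reduction modulo `ħ` on the first cohomology of `𝔸_ħ^×` has trivial kernel. -/
theorem mapH1_quantumReduction_eq_one_iff [T2Space M] [SecondCountableTopology M]
    [IsManifold (𝓡 (2 * n)) ∞ M] {Ω : SymplecticForm n M} (A : DeformationQuantization Ω)
    {J : Type v} {U : J → Opens M} (hU : ∀ x, ∃ i, x ∈ U i)
    (c : PresheafOfGroups.H1 (quantumUnits A) U) :
    mapH1 U (quantumReduction A) c = 1 ↔ c = 1 := by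
  refine ⟨fun hc => (quantumSheaf A).eq_one_of_mapH1_unitsRed_eq_one hU c hc, ?_⟩
  rintro rfl
  refine congrArg (Quot.mk _) (cocycle_ext U ?_)
  ext i j T p q
  exact map_one (((quantumReduction A).app (Opposite.op T)).hom)

/-! ### The exponential and coefficients of formal power series -/

/-- A series is determined by its derivative and constant term, and `(exp f)' = exp f · f'`. If `exp
f = 1`, then `f' = 0`. A preimage of `g` is its formal logarithm, the primitive of `g'/g` without
constant term. -/
theorem expHom_bijective : Function.Bijective expHom := by
  refine ⟨(injective_iff_map_eq_one _).2 fun f hf => ?_, fun g => ?_⟩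
  · have h1 : expSeries f.toAdd.1 = 1 := congrArg (fun x => (x.1.1 : PowerSeries ℂ)) hf
    have h2 := derivative_expSeries f.toAdd.2
    rw [h1, PowerSeries.derivative_one, one_mul] at h2
    have h3 : f.toAdd.1 = 0 := by
      refine PowerSeries.derivative.ext ?_ ?_
      · rw [← h2, map_zero]
      · rw [map_zero]
        exact f.toAdd.2
    exact Multiplicative.toAdd.injective (Subtype.ext h3)
  · have hg0 : PowerSeries.constantCoeff g.1.1 = 1 := congrArg Units.val g.2
    -- The logarithmic derivative `g'/g`, with `g.1.2` the inverse of `g`; `f` is its primitive.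
    let d : PowerSeries ℂ := PowerSeries.derivative ℂ g.1.1 * g.1.2
    let f : PowerSeries ℂ := PowerSeries.mk fun k => if k = 0 then 0 else
      PowerSeries.coeff (k - 1) d / k
    have hf : f ∈ hbarSeries := by
      change PowerSeries.constantCoeff f = 0
      rw [← PowerSeries.coeff_zero_eq_constantCoeff_apply, PowerSeries.coeff_mk, if_pos rfl]
    have hd : PowerSeries.derivative ℂ f = d := by
      ext k
      rw [PowerSeries.coeff_derivative, PowerSeries.coeff_mk, if_neg k.succ_ne_zero,
        Nat.add_sub_cancel, Nat.cast_succ, div_mul_cancel₀]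
      exact Nat.cast_add_one_ne_zero k
    have hg1 : PowerSeries.derivative ℂ g.1.1 = g.1.1 * d := by
      rw [mul_left_comm]
      have := g.1.3
      rw [this, mul_one]
    -- The product has derivative `g d exp(-f) - g exp(-f) d = 0` and constant term 1.
    have key : g.1.1 * expSeries (-f) = 1 := by
      refine PowerSeries.derivative.ext ?_ ?_
      · rw [Derivation.leibniz, derivative_expSeries (neg_mem hf), hg1, map_neg, hd]
        simp only [smul_eq_mul, PowerSeries.derivative_one]
        ring
      · rw [map_mul, constantCoeff_expSeries (neg_mem hf), hg0, map_one, one_mul]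
    refine ⟨Multiplicative.ofAdd ⟨f, hf⟩, Subtype.ext (Units.ext ?_)⟩
    change expSeries f = g.1.1
    rw [← mul_one (expSeries f), ← key, mul_left_comm, expSeries_mul_neg hf, mul_one]

/-- The series with given coefficients in positive degrees. -/
def hbarMk (b : ℕ → ℂ) : hbarSeries :=
  ⟨PowerSeries.mk fun k => if k = 0 then 0 else b k, by
    change PowerSeries.constantCoeff _ = 0
    rw [← PowerSeries.coeff_zero_eq_constantCoeff_apply, PowerSeries.coeff_mk, if_pos rfl]⟩

theorem coeffHom_zero (f : Multiplicative hbarSeries) : coeffHom 0 f = 1 := by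
  change Multiplicative.ofAdd (PowerSeries.coeff 0 f.toAdd.1) = 1
  rw [PowerSeries.coeff_zero_eq_constantCoeff_apply, show PowerSeries.constantCoeff f.toAdd.1 = 0
    from f.toAdd.2, ofAdd_zero]

theorem coeffHom_hbarMk (b : ℕ → ℂ) {k : ℕ} (hk : k ≠ 0) :
    coeffHom k (Multiplicative.ofAdd (hbarMk b)) = Multiplicative.ofAdd (b k) := by
  change Multiplicative.ofAdd (PowerSeries.coeff k (hbarMk b).1) = _
  rw [hbarMk, PowerSeries.coeff_mk, if_neg hk]

theorem hbarSeries_ext {f g : Multiplicative hbarSeries}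
    (h : ∀ k ≠ 0, coeffHom k f = coeffHom k g) : f = g := by
  refine Multiplicative.toAdd.injective (Subtype.ext (PowerSeries.ext fun k => ?_))
  rcases eq_or_ne k 0 with rfl | hk
  · exact (coeffHom_zero f).trans (coeffHom_zero g).symm
  · exact h k hk

/-! ### Cohomology of constant sheaves -/

section Constant

open PresheafOfGroups

variable {X : Type u} [TopologicalSpace X] {J : Type v} {U : J → Opens X}

/-- The value of a section of a constant sheaf at a point. -/
abbrev constVal {G : Type} [CommGroup G] {T : Opens X}
    (f : (toGrp (constSheaf X G)).obj (Opposite.op T)) (x : T) : G :=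
  LocallyConstant.toFun (X := T) (Y := G) f x

theorem mapCechH1_constSheafMap_comp_eq {G G' : Type} [CommGroup G] [CommGroup G'] {φ : G →* G'}
    {ψ : G' →* G} (h : ∀ g, ψ (φ g) = g) (x : CechH1 U (constSheaf X G)) :
    mapCechH1 U (constSheafMap X ψ) (mapCechH1 U (constSheafMap X φ) x) = x := by
  obtain ⟨γ⟩ := x
  refine congrArg (Quot.mk _) (cocycle_ext U ?_)
  ext i j T p q
  exact LocallyConstant.ext fun x => h _

/-- An isomorphism of groups induces an isomorphism on the first cohomology of constant sheaves. -/
theorem bijective_mapCechH1_constSheafMap {G G' : Type} [CommGroup G] [CommGroup G'] {φ : G →* G'}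
    (hφ : Function.Bijective φ) : Function.Bijective (mapCechH1 U (constSheafMap X φ)) := by
  let e := MulEquiv.ofBijective φ hφ
  exact Function.bijective_iff_has_inverse.2 ⟨mapCechH1 U (constSheafMap X e.symm.toMonoidHom),
    mapCechH1_constSheafMap_comp_eq e.symm_apply_apply,
    mapCechH1_constSheafMap_comp_eq e.apply_symm_apply⟩

/-- Preconnectedness covers empty intersections, about which a good cover says nothing, and still
makes locally constant functions constant. -/
theorem IsGoodCover.preconnectedSpace (hU : IsGoodCover U) (S : Finset J) (hS : S.Nonempty)
    (V : Opens X) (hV : (V : Set X) = ⋂ i ∈ S, (U i : Set X)) : PreconnectedSpace V := by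
  rcases isEmpty_or_nonempty V with h | ⟨⟨x, hx⟩⟩
  · exact ⟨Set.subsingleton_of_subsingleton.isPreconnected⟩
  · have := hU.contractible S hS ⟨x, hV ▸ hx⟩
    rw [← hV] at this
    exact (inferInstance : ConnectedSpace V).toPreconnectedSpace

variable (U) in
/-- The map from the first cohomology of `ħℂ⟦ħ⟧` to formal series in the cohomology of `ℂ` that
takes coefficients. -/
def cechCoeff : Additive (CechH1 U (constSheaf X (Multiplicative hbarSeries))) →+
    formalHbar (CechH1Complex U) where
  toFun x := ⟨fun k => Additive.ofMul (mapCechH1 U (constSheafMap X (coeffHom k)) x.toMul), by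
    obtain ⟨γ⟩ := x
    refine congrArg (Quot.mk _) (cocycle_ext U ?_)
    ext i j T p q
    exact LocallyConstant.ext fun x => coeffHom_zero _⟩
  map_zero' := Subtype.ext (funext fun k => map_one (mapCechH1 U (constSheafMap X (coeffHom k))))
  map_add' x y := Subtype.ext (funext fun k =>
    map_mul (mapCechH1 U (constSheafMap X (coeffHom k))) x.toMul y.toMul)

/-- The cochain that trivializes the coefficient of `ħᵏ` is one number `b k i` on each `U i`. For
fixed `i` these numbers form a series, a constant section; locally constant coefficients alone need
not give a locally constant series. -/
theorem cechCoeff_injective (hU : ∀ i, PreconnectedSpace (U i)) :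
    Function.Injective (cechCoeff U) := by
  refine (injective_iff_map_eq_zero _).2 fun x hx => ?_
  obtain ⟨γ⟩ := x
  have h : ∀ k, ∃ b : J → Multiplicative ℂ, ∀ (i j : J) {T : Opens X} (p : T ⟶ U i) (q : T ⟶ U j)
      (x : T), b i * coeffHom k (constVal (γ.ev i j p q) x) = b j := by
    intro k
    have hk : OneCocycle.class (mapCocycle U (Functor.whiskerRight (constSheafMap X (coeffHom k))
        (forget₂ CommGrpCat GrpCat)) γ) = OneCocycle.class 1 := congrFun (congrArg Subtype.val hx) k
    obtain ⟨α, hα⟩ := (OneCocycle.class_eq_iff _ _).1 hk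
    have hc : ∀ i, ∃ b, (α i : LocallyConstant (U i) (Multiplicative ℂ)) =
        LocallyConstant.const _ b := fun i => LocallyConstant.exists_eq_const _
    choose b hb using hc
    refine ⟨b, fun i j T p q x => ?_⟩
    have e := congrArg (fun f : LocallyConstant T (Multiplicative ℂ) => f x) (hα i j p q)
    rw [hb, hb] at e
    exact e.trans (one_mul _)
  choose b hb using h
  refine (OneCocycle.class_eq_iff γ 1).2
    ⟨fun i => LocallyConstant.const _ (Multiplicative.ofAdd (hbarMk fun k => (b k i).toAdd)),
      fun i j T p q => LocallyConstant.ext fun x => hbarSeries_ext fun k hk => ?_⟩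
  refine (map_mul (coeffHom k) _ _).trans (Eq.trans ?_ (map_mul (coeffHom k) _ _).symm)
  refine (congrArg (· * _) (coeffHom_hbarMk _ hk)).trans ?_
  refine (hb k i j p q x).trans (Eq.trans ?_ (congrArg (_ * ·) (coeffHom_hbarMk _ hk)).symm)
  refine Eq.trans ?_ (congrArg (· * _) (map_one (coeffHom k))).symm
  exact (one_mul (b k j)).symm

/-- Representing cocycles of all coefficients are constants `g k i j` on double intersections, so
they assemble into one cocycle of constant series. -/
theorem cechCoeff_surjective (hU : ∀ i j, PreconnectedSpace ↥(U i ⊓ U j)) :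
    Function.Surjective (cechCoeff U) := by
  rintro ⟨c, hc0⟩
  have hc : ∀ k, ∃ γ : OneCocycle (toGrp (constSheaf X (Multiplicative ℂ))) U,
      Additive.ofMul (OneCocycle.class γ) = c k := fun k => Quot.exists_rep (c k)
  choose γ hγ using hc
  have hg : ∀ k i j, ∃ g : Multiplicative ℂ, ∀ {T : Opens X} (p : T ⟶ U i) (q : T ⟶ U j) (x : T),
      constVal ((γ k).ev i j p q) x = g := by
    intro k i j
    have hconst : ∃ g, ((γ k).ev i j (homOfLE inf_le_left : U i ⊓ U j ⟶ U i)
        (homOfLE inf_le_right) : LocallyConstant ↥(U i ⊓ U j) (Multiplicative ℂ)) =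
        LocallyConstant.const _ g := LocallyConstant.exists_eq_const _
    obtain ⟨g, hg⟩ := hconst
    refine ⟨g, fun {T} p q x => ?_⟩
    -- Values on `T` are restricted from `U i ⊓ U j`, so `T` itself need not be connected.
    have hpre := (γ k).ev_precomp i j (homOfLE (le_inf (leOfHom p) (leOfHom q)))
      (homOfLE inf_le_left) (homOfLE inf_le_right)
    rw [hg] at hpre
    exact (congrArg (fun f : LocallyConstant T (Multiplicative ℂ) => f x) hpre).symm
  choose g hg using hg
  let δ : OneCocycle (toGrp (constSheaf X (Multiplicative hbarSeries))) U :=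
    { ev := fun i j T _ _ => LocallyConstant.const T
        (Multiplicative.ofAdd (hbarMk fun k => (g k i j).toAdd))
      ev_precomp := fun _ _ _ _ _ _ _ => rfl
      ev_trans := fun i j l T p q r => LocallyConstant.ext fun x => hbarSeries_ext fun k hk => by
        have e := congrArg (fun f : LocallyConstant T (Multiplicative ℂ) => f x)
          ((γ k).ev_trans i j l p q r)
        refine (map_mul (coeffHom k) _ _).trans ?_
        refine (congrArg₂ (· * ·) (coeffHom_hbarMk _ hk) (coeffHom_hbarMk _ hk)).trans ?_
        refine Eq.trans ?_ (coeffHom_hbarMk _ hk).symm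
        refine Eq.trans ?_ (e.trans (hg k i l p r x))
        exact congrArg₂ (· * ·) (hg k i j p q x).symm (hg k j l q r x).symm }
  refine ⟨Additive.ofMul (OneCocycle.class δ), Subtype.ext (funext fun k => ?_)⟩
  rcases eq_or_ne k 0 with rfl | hk
  -- `hbarMk` discards degree 0, where both sides vanish by membership in `formalHbar`.
  · exact (cechCoeff U (Additive.ofMul (OneCocycle.class δ))).2.trans hc0.symm
  · refine Eq.trans ?_ (hγ k)
    refine congrArg (Quot.mk _) (cocycle_ext U ?_)
    ext i j T p q
    exact LocallyConstant.ext fun x => (coeffHom_hbarMk _ hk).trans (hg k i j p q x).symm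

/-- For a good cover, the first cohomology of `1 + ħℂ⟦ħ⟧` is computed by the coefficients of
logarithms. -/
theorem exists_cech_addEquiv_formalHbar (hU : IsGoodCover U) :
    ∃ P : Additive (CechH1 U (constSheaf X oneAddHbarSeries)) ≃+ formalHbar (CechH1Complex U),
      ∀ (x : CechH1 U (constSheaf X (Multiplicative hbarSeries))) (k : ℕ),
        (P (Additive.ofMul (mapCechH1 U (constSheafMap X expHom) x))).1 k =
          Additive.ofMul (mapCechH1 U (constSheafMap X (coeffHom k)) x) := by
  classical
  have h1 : ∀ i, PreconnectedSpace (U i) := fun i =>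
    hU.preconnectedSpace {i} (Finset.singleton_nonempty i) (U i) (by simp)
  have h2 : ∀ i j, PreconnectedSpace ↥(U i ⊓ U j) := fun i j =>
    hU.preconnectedSpace {i, j} (Finset.insert_nonempty i {j}) (U i ⊓ U j) (by simp)
  let e := MulEquiv.ofBijective (mapCechH1 U (constSheafMap X expHom))
    (bijective_mapCechH1_constSheafMap expHom_bijective)
  let κ := AddEquiv.ofBijective (cechCoeff U) ⟨cechCoeff_injective h1, cechCoeff_surjective h2⟩
  -- Invert `exp_*`, then take coefficients; the required formula is then immediate.
  refine ⟨(MulEquiv.toAdditive e).symm.trans κ, fun x k => ?_⟩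
  change (κ (Additive.ofMul (e.symm (e x)))).1 k = _
  rw [e.symm_apply_apply]
  rfl

end Constant

end DefQuant

end

theorem mainTheorem12 {n : ℕ} {M : Type*} [TopologicalSpace M] [T2Space M]
    [SecondCountableTopology M] [ChartedSpace (E n) M] [IsManifold (𝓡 (2 * n)) ∞ M]
    (Ω : SymplecticForm n M) (A : DeformationQuantization Ω)
    {J : Type*} (U : J → Opens M) (hU : IsGoodCover U) :
    -- `P₁`, induced by reduction modulo `ħ`, is an isomorphism of groups
    Function.Bijective (mapCechH1 U (centerReduction n M)) ∧
    -- `P₂`, induced by reduction modulo `ħ`, is pointed and has trivial kernel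
    (∀ c : PresheafOfGroups.H1 (quantumUnits A) U,
      mapH1 U (quantumReduction A) c = 1 ↔ c = 1) ∧
    -- `exp` induces an isomorphism on `Ȟ¹`, and through it `P₃` takes coefficients
    (Function.Bijective (mapCechH1 U (constSheafMap M expHom)) ∧
      ∃ P₃ : Additive (CechH1 U (constSheaf M oneAddHbarSeries)) ≃+
          formalHbar (CechH1Complex U),
        ∀ (x : CechH1 U (constSheaf M (Multiplicative hbarSeries))) (k : ℕ),
          (P₃ (Additive.ofMul (mapCechH1 U (constSheafMap M expHom) x))).1 k =
            Additive.ofMul (mapCechH1 U (constSheafMap M (coeffHom k)) x)) :=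
  ⟨bijective_mapCechH1_centerReduction hU.covers,
    mapH1_quantumReduction_eq_one_iff A hU.covers,
    bijective_mapCechH1_constSheafMap expHom_bijective,
    exists_cech_addEquiv_formalHbar hU⟩
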